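/- Let $\mathcal C$ be a triangulated category and let $\mathcal D=(\mathcal D^{\le 0},\mathcal D^{\ge 0})$ and $\mathcal T=(\mathcal T^{\le 0},\mathcal T^{\ge 0})$ be $t$-structures on $\mathcal C$, with $\mathcal D^{\le m}=\mathcal D^{\le 0}[-m]$, $\mathcal D^{\ge m}=\mathcal D^{\ge 0}[-m]$ (and likewise for $\mathcal T$), hearts $\mathcal H_{\mathcal D}=\mathcal D^{\le 0}\cap\mathcal D^{\ge 0}$ and $\mathcal H_{\mathcal T}=\mathcal T^{\le 0}\cap\mathcal T^{\ge 0}$, and truncation functors $\delta^{\le m},\delta^{\ge m}$ of $\mathcal D$. The pair $(\mathcal D,\mathcal T)$ is *filterable* if either $\mathcal D^{\ge i}\cap\mathcal T^{\ge 0}$ is the co-aisle of a $t$-structure for every $i\in\mathbb Z$, or $\mathcal D^{\le i}\cap\mathcal T^{\le 0}$ is the aisle of a $t$-structure for every $i\in\mathbb Z$. It is *of type* $(n,k)$, with $n\in\mathbb N$ and $k\in\mathbb Z$, if $k$ is the largest integer with $\mathcal T^{\le k}\subseteq\mathcal D^{\le 0}$ and $n$ is the smallest natural number with $\mathcal D^{\le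 -n}\subseteq\mathcal T^{\le k}$. It is *$n$-tilting* (resp. *$n$-cotilting*) if it is filterable of type $(n,0)$ and every object of $\mathcal H_{\mathcal D}$ embeds in $\mathcal H_{\mathcal D}$ into an object of $\mathcal H_{\mathcal D}\cap\mathcal H_{\mathcal T}$ (resp. is a quotient in $\mathcal H_{\mathcal D}$ of an object of $\mathcal H_{\mathcal D}\cap\mathcal H_{\mathcal T}[-n]$). The $t$-structure $\mathcal T$ is *left* (resp. *right*) *$\mathcal D$-compatible* if $\delta^{\le m}(\mathcal T^{\le 0})\subseteq\mathcal T^{\le 0}$ (resp. $\delta^{\ge m}(\mathcal T^{\ge 0})\subseteq\mathcal T^{\ge 0}$) for all $m\in\mathbb Z$. 1. If $(\mathcal D,\mathcal T)$ is $n$-tilting, then $\mathcal T$ is left $\mathcal D$-compatible if and only if $n=0$ or $n=1$. 2. If $(\mathcal D,\mathcal T)$ is $n$-cotilting, then $\mathcal T$ is right $\mathcal D$-compatible if and only if $n=0$ or $n=1$; moreover, if $n=0$ or $n=1$, then $\mathcal T$ is also left $\mathcal D$-compatible. -/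

import Mathlib

open CategoryTheory CategoryTheory.Limits CategoryTheory.Triangulated

universe v u

namespace TStructurePair

section Generation

variable {A : Type u} [Category.{v} A]

/-- The full subcategory `S` cogenerates `A`: every object of `A` embeds in an object of `S`. -/
def Cogenerates (S : ObjectProperty A) : Prop :=
  ∀ M : A, ∃ X : A, S X ∧ ∃ i : M ⟶ X, Mono i

/-- The full subcategory `S` generates `A`: every object of `A` is a quotient of an object
of `S`. -/
def Generates (S : ObjectProperty A) : Prop :=
  ∀ M : A, ∃ X : A, S X ∧ ∃ p : X ⟶ M, Epi p

end Generation

variable {C : Type u} [Category.{v} C] [Preadditive C] [HasZeroObject C] [HasShift C ℤ]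
  [∀ n : ℤ, (shiftFunctor C n).Additive] [Pretriangulated C]

/-- The pair `(D, T)` has shift `k` and gap `n`: `k` is the greatest integer such that
`T^{≤ k} ⊆ D^{≤ 0}` and `n` is the least natural number such that `D^{≤ -n} ⊆ T^{≤ k}`. -/
structure IsOfType (D T : TStructure C) (n : ℕ) (k : ℤ) : Prop where
  shift : IsGreatest {j : ℤ | T.le j ≤ D.le 0} k
  gap : IsLeast {m : ℕ | D.le (-(m : ℤ)) ≤ T.le k} n

/-- For every `i`, the intersection `D^{≥ i} ∩ T^{≥ 0}` is the co-aisle of a t-structure. -/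
def IsRightFilterable (D T : TStructure C) : Prop :=
  ∀ i : ℤ, ∃ E : TStructure C, E.ge 0 = D.ge i ⊓ T.ge 0

/-- For every `i`, the intersection `D^{≤ i} ∩ T^{≤ 0}` is the aisle of a t-structure. -/
def IsLeftFilterable (D T : TStructure C) : Prop :=
  ∀ i : ℤ, ∃ E : TStructure C, E.le 0 = D.le i ⊓ T.le 0

/-- A pair is filterable if it is right or left filterable. -/
def IsFilterable (D T : TStructure C) : Prop :=
  IsRightFilterable D T ∨ IsLeftFilterable D T

/-- The pair `(D, T)` is `n`-tilting: it is filterable of type `(n, 0)` and `H_D ∩ H_T`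
cogenerates the heart `H_D`. -/
structure IsTilting (D T : TStructure C) (n : ℕ) : Prop where
  filterable : IsFilterable D T
  ofType : IsOfType D T n 0
  cogenerates : Cogenerates (T.heart.inverseImage D.heart.ι)

/-- The pair `(D, T)` is `n`-cotilting: it is filterable of type `(n, 0)` and `H_D ∩ H_T[-n]`
generates the heart `H_D`; here `X` lies in `H_T[-n]` when `X[n]` lies in `H_T`. -/
structure IsCotilting (D T : TStructure C) (n : ℕ) : Prop where
  filterable : IsFilterable D T
  ofType : IsOfType D T n 0
  generates : Generates ((T.heart.shift (n : ℤ)).inverseImage D.heart.ι)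

/-- `T` is left `D`-compatible: `T^{≤ 0}` is stable under all truncation functors
`δ^{≤ m}` of `D`. -/
def IsLeftCompatible (D T : TStructure C) : Prop :=
  ∀ (m : ℤ) (X : C), T.le 0 X → T.le 0 ((D.truncLE m).obj X)

/-- `T` is right `D`-compatible: `T^{≥ 0}` is stable under all truncation functors
`δ^{≥ m}` of `D`. -/
def IsRightCompatible (D T : TStructure C) : Prop :=
  ∀ (m : ℤ) (X : C), T.ge 0 X → T.ge 0 ((D.truncGE m).obj X)

end TStructurePair

namespace TStructurePair

section Heart

variable {C : Type u} [Category.{v} C] [Preadditive C] [HasZeroObject C] [HasShift C ℤ]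
  [∀ n : ℤ, (shiftFunctor C n).Additive] [Pretriangulated C]

open Pretriangulated

/-! If $n\le 1$, then $\mathcal T^{\le 0}$ lies between $\mathcal D^{\le -1}$ and $\mathcal D^{\le
0}$, so each $\delta^{\le m}$ either fixes an object of $\mathcal T^{\le 0}$ or sends it into
$\mathcal D^{\le -1}$; co-aisles behave dually. Conversely, splice two embeddings into $M\to X\to
X'$ with $X,X'\in\mathcal H_{\mathcal D}\cap\mathcal H_{\mathcal T}$. The cone of $X\to X'$ lies in
$\mathcal T^{\le 0}$ and has $M[1]$ as its negative $\mathcal D$-truncation, so left compatibility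
gives $\mathcal H_{\mathcal D}[1]\subseteq\mathcal T^{\le 0}$. Dévissage along $\mathcal
D$-cohomology yields $\mathcal D^{\le -1}\subseteq\mathcal T^{\le 0}$, and minimality of $n$
concludes. The cotilting case uses $X'\to X\to M$ and instead ends with maximality of the shift. -/

/-- A monomorphism in the heart of a t-structure is completed to a distinguished triangle by an
object of the heart. -/
lemma exists_distTriang_of_mono [IsTriangulated C] (t : TStructure C)
    {M X : t.heart.FullSubcategory} (i : M ⟶ X) [Mono i] :
    ∃ (N : t.heart.FullSubcategory) (g : X.obj ⟶ N.obj) (h : N.obj ⟶ M.obj⟦(1 : ℤ)⟧),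
      Triangle.mk i.hom g h ∈ distTriang C := by
  obtain ⟨W, g, h, hT⟩ := distinguished_cocone_triangle i.hom
  obtain ⟨hM₁, hM₂⟩ := (t.mem_heart_iff _).1 M.property
  obtain ⟨hX₁, hX₂⟩ := (t.mem_heart_iff _).1 X.property
  have hM₁' : t.IsLE (M.obj⟦(1 : ℤ)⟧) (-1) := t.isLE_shift _ 0 1 (-1)
  have hM₂' : t.IsGE (M.obj⟦(1 : ℤ)⟧) (-1) := t.isGE_shift _ 0 1 (-1)
  have hW₁ : t.IsLE W 0 := t.isLE₂ _ (rot_of_distTriang _ hT) 0 hX₁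
    (t.isLE_of_le (M.obj⟦(1 : ℤ)⟧) (-1) 0)
  have hW₂ : t.IsGE W (-1) := t.isGE₂ _ (rot_of_distTriang _ hT) (-1)
    (t.isGE_of_ge X.obj (-1) 0) hM₂'
  have hK₁ : t.IsLE ((t.truncLT 0).obj W) (-1) := t.isLE_truncLT_obj ..
  have hK₂ : t.IsGE ((t.truncLT 0).obj W) (-1) := inferInstance
  -- `K` is $H^{-1}$ of the cone, the would-be kernel of `i`; its map to `M` vanishes because `i` is
  -- mono.
  let K : t.heart.FullSubcategory := ⟨((t.truncLT 0).obj W)⟦(-1 : ℤ)⟧, (t.mem_heart_iff _).2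
    ⟨t.isLE_shift _ (-1) (-1) 0, t.isGE_shift _ (-1) (-1) 0⟩⟩
  let e : K.obj⟦(1 : ℤ)⟧ ≅ (t.truncLT 0).obj W := (shiftEquiv C (1 : ℤ)).counitIso.app _
  obtain ⟨k, hk⟩ := (shiftFunctor C (1 : ℤ)).map_surjective (e.hom ≫ (t.truncLTι 0).app W ≫ h)
  have hki : k ≫ i.hom = 0 := (shiftFunctor C (1 : ℤ)).map_injective (by
    have : h ≫ i.hom⟦(1 : ℤ)⟧' = 0 := comp_distTriang_mor_zero₃₁ _ hT
    simp [hk, this])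
  have hk0 : k = 0 := by
    have : t.heart.homMk (X := K) (Y := M) k = 0 := by
      rw [← cancel_mono i]
      ext
      simpa using hki
    exact congr_arg (·.hom) this
  have hι : (t.truncLTι 0).app W ≫ h = 0 := by
    rw [← cancel_epi e.hom, ← hk, hk0]
    simp
  obtain ⟨l, hl⟩ := Triangle.coyoneda_exact₃ _ hT _ hι
  have hι' : (t.truncLTι 0).app W = 0 := by
    rw [hl, t.zero_of_isLE_of_isGE l (-1) 0 (by lia) hK₁ hX₂]
    exact zero_comp
  have hW₃ : t.IsGE W 0 := by
    rw [t.isGE_iff_orthogonal (-1) 0 (by lia)]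
    intro Y f _
    rw [← t.liftTruncLT_ι f (-1) 0 (by lia), hι', comp_zero]
  exact ⟨⟨W, (t.mem_heart_iff _).2 ⟨hW₁, hW₃⟩⟩, g, h, hT⟩

/-- An epimorphism in the heart of a t-structure is completed to a distinguished triangle by an
object of the heart. -/
lemma exists_distTriang_of_epi [IsTriangulated C] (t : TStructure C)
    {X M : t.heart.FullSubcategory} (p : X ⟶ M) [Epi p] :
    ∃ (K : t.heart.FullSubcategory) (i : K.obj ⟶ X.obj) (h : M.obj ⟶ K.obj⟦(1 : ℤ)⟧),
      Triangle.mk i p.hom h ∈ distTriang C := by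
  obtain ⟨K, i, h, hT⟩ := distinguished_cocone_triangle₁ p.hom
  obtain ⟨hM₁, hM₂⟩ := (t.mem_heart_iff _).1 M.property
  obtain ⟨hX₁, hX₂⟩ := (t.mem_heart_iff _).1 X.property
  have hM₁' : t.IsLE (M.obj⟦(-1 : ℤ)⟧) 1 := t.isLE_shift _ 0 (-1) 1
  have hM₂' : t.IsGE (M.obj⟦(-1 : ℤ)⟧) 1 := t.isGE_shift _ 0 (-1) 1
  have hK₁ : t.IsLE K 1 := t.isLE₂ _ (inv_rot_of_distTriang _ hT) 1 hM₁'
    (t.isLE_of_le X.obj 0 1)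
  have hK₂ : t.IsGE K 0 := t.isGE₂ _ (inv_rot_of_distTriang _ hT) 0
    (t.isGE_of_ge (M.obj⟦(-1 : ℤ)⟧) 0 1) hX₂
  have hQ₁ : t.IsLE ((t.truncGE 1).obj K) 1 := inferInstance
  have hQ₂ : t.IsGE ((t.truncGE 1).obj K) 1 := inferInstance
  have hQ₃ : t.IsGE (((t.truncGE 1).obj K)⟦(1 : ℤ)⟧) 0 := t.isGE_shift _ 1 1 0
  have hX₃ : t.IsLE (X.obj⟦(1 : ℤ)⟧) (-1) := t.isLE_shift _ 0 1 (-1)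
  -- `Q` is $H^1$ of the fibre, the would-be cokernel of `p`.
  let Q : t.heart.FullSubcategory := ⟨((t.truncGE 1).obj K)⟦(1 : ℤ)⟧, (t.mem_heart_iff _).2
    ⟨t.isLE_shift _ 1 1 0, hQ₃⟩⟩
  have hq : h ≫ ((t.truncGEπ 1).app K)⟦(1 : ℤ)⟧' = 0 := by
    have : t.heart.homMk (X := M) (Y := Q) (h ≫ ((t.truncGEπ 1).app K)⟦(1 : ℤ)⟧') = 0 := by
      rw [← cancel_epi p]
      ext
      have : p.hom ≫ h = 0 := comp_distTriang_mor_zero₂₃ _ hT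
      simp [reassoc_of% this]
    exact congr_arg (·.hom) this
  obtain ⟨l, hl⟩ := Triangle.yoneda_exact₃ _ (rot_of_distTriang _ hT) _ hq
  have hπ : (t.truncGEπ 1).app K = 0 := (shiftFunctor C (1 : ℤ)).map_injective (by
    rw [Functor.map_zero]
    refine hl.trans ?_
    rw [t.zero_of_isLE_of_isGE l (-1) 0 (by lia) hX₃ hQ₃]
    exact comp_zero)
  have hK₃ : t.IsLE K 0 := by
    rw [t.isLE_iff_orthogonal 0 1 (by lia)]
    intro Y f _
    rw [← t.π_descTruncGE f 1, hπ, zero_comp]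
  exact ⟨⟨K, (t.mem_heart_iff _).2 ⟨hK₃, hK₂⟩⟩, i, h, hT⟩

lemma le_add_of_le {S R : TStructure C} {a b : ℤ} (h : S.le a ≤ R.le b) (c : ℤ) :
    S.le (a + c) ≤ R.le (b + c) := by
  intro X hX
  have := h _ (S.le_shift (a + c) c a (by lia) X hX)
  rw [R.le_iff_isLE] at this ⊢
  exact R.isLE_of_shift X (b + c) c b

lemma ge_of_le {S R : TStructure C} {a b : ℤ} (h : S.le a ≤ R.le b) :
    R.ge (b + 1) ≤ S.ge (a + 1) := by
  intro X hX
  rw [S.ge_iff_isGE, S.isGE_iff_orthogonal a _ rfl]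
  intro Y f hY
  exact R.zero_of_isLE_of_isGE f b (b + 1) (by lia) ⟨h _ hY.le⟩ ⟨hX⟩

lemma le_of_ge {S R : TStructure C} {a b : ℤ} (h : R.ge (b + 1) ≤ S.ge (a + 1)) :
    S.le a ≤ R.le b := by
  intro X hX
  rw [R.le_iff_isLE, R.isLE_iff_orthogonal b _ rfl]
  intro Y f hY
  exact S.zero_of_isLE_of_isGE f a (a + 1) (by lia) ⟨hX⟩ ⟨h _ hY.ge⟩

section Compatible

variable {D T : TStructure C}

lemma isLeftCompatible_of_le (h₀ : T.le 0 ≤ D.le 0) (h₁ : D.le (-1) ≤ T.le 0) :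
    IsLeftCompatible D T := by
  intro m X hX
  have hX' : D.IsLE X 0 := ⟨h₀ _ hX⟩
  by_cases hm : 0 ≤ m
  · have : IsIso ((D.truncLTι (m + 1)).app X) :=
      (D.isLE_iff_isIso_truncLTι_app m (m + 1) rfl X).1 (D.isLE_of_le X 0 m)
    exact (T.le 0).prop_of_iso (asIso ((D.truncLTι (m + 1)).app X)).symm hX
  · have : D.IsLE ((D.truncLT (m + 1)).obj X) (-1) := D.isLE_truncLT_obj _ _ _ (by lia)
    exact h₁ _ this.le

lemma isRightCompatible_of_le (h₀ : T.le 0 ≤ D.le 0) (h₁ : D.le (-1) ≤ T.le 0) :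
    IsRightCompatible D T := by
  intro m X hX
  have hX' : D.IsGE X (-1) := by
    have h : D.IsGE (X⟦(-1 : ℤ)⟧) 0 := ⟨ge_of_le h₁ _ (T.ge_shift 0 (-1) 1 (by lia) X hX)⟩
    exact D.isGE_of_shift X (-1) (-1) 0
  by_cases hm : m ≤ -1
  · have : IsIso ((D.truncGEπ m).app X) :=
      (D.isGE_iff_isIso_truncGEπ_app m X).1 (D.isGE_of_ge X m (-1))
    exact (T.ge 0).prop_of_iso (asIso ((D.truncGEπ m).app X)) hX
  · have : D.IsGE ((D.truncGE m).obj X) 0 := D.isGE_of_ge _ 0 m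
    have h := ge_of_le (le_add_of_le h₀ (-1))
    exact h _ this.ge

lemma IsOfType.le_neg_one {n : ℕ} (h : IsOfType D T n 0) (hn : n = 0 ∨ n = 1) :
    D.le (-1) ≤ T.le 0 :=
  (D.le_monotone (by lia)).trans h.gap.1

lemma IsLeftCompatible.le_truncLT (h : IsLeftCompatible D T) (m : ℤ) {X : C} (hX : T.le 0 X) :
    T.le 0 ((D.truncLT m).obj X) := by
  have := h (m - 1) X hX
  rwa [TStructure.truncLE, sub_add_cancel] at this

variable [IsTriangulated C]

/-- If `T` is left `D`-compatible and the heart of `D` is cogenerated by `H_D ∩ H_T`, then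
`H_D[1]` is contained in `T^{≤ 0}`. -/
lemma isLE_shift_one_of_isLeftCompatible (h : IsLeftCompatible D T)
    (hc : Cogenerates (T.heart.inverseImage D.heart.ι)) (M : D.heart.FullSubcategory) :
    T.IsLE (M.obj⟦(1 : ℤ)⟧) 0 := by
  obtain ⟨X, hX, i, _⟩ := hc M
  obtain ⟨N, g, k, hT⟩ := exists_distTriang_of_mono D i
  obtain ⟨X', hX', i', _⟩ := hc N
  obtain ⟨N', g', k', hT'⟩ := exists_distTriang_of_mono D i'
  obtain ⟨W, a, b, hW⟩ := distinguished_cocone_triangle (g ≫ i'.hom)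
  -- Gives a triangle $M[1]\to W\to N'\to M[2]$, where $M[1]\in\mathcal D^{\le -1}$ and
  -- $N'\in\mathcal D^{\ge 0}$.
  let H := someOctahedron rfl (rot_of_distTriang _ hT) hT' hW
  have hX₀ : T.IsLE X.obj 0 := ⟨hX.1⟩
  have hX₁ : T.IsLE (X.obj⟦(1 : ℤ)⟧) 0 := by
    have := T.isLE_shift X.obj 0 1 (-1)
    exact T.isLE_of_le _ (-1) 0
  have hW₀ : T.IsLE W 0 := T.isLE₂ _ (rot_of_distTriang _ hW) 0 ⟨hX'.1⟩ hX₁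
  have hM : D.IsLE M.obj 0 := ⟨M.property.1⟩
  have hM₁ : D.IsLE (M.obj⟦(1 : ℤ)⟧) (-1) := D.isLE_shift _ 0 1 (-1)
  let φ : M.obj⟦(1 : ℤ)⟧ ⟶ W := H.m₁
  have e₁ : IsIso ((D.truncLT 0).map φ) :=
    D.isIso₁_truncLT_map_of_isGE H.triangle H.mem 0 ⟨N'.property.2⟩
  have e₂ : IsIso ((D.truncLTι 0).app (M.obj⟦(1 : ℤ)⟧)) :=
    (D.isLE_iff_isIso_truncLTι_app (-1) 0 (by lia) _).1 hM₁
  have h₁ : T.le 0 ((D.truncLT 0).obj (M.obj⟦(1 : ℤ)⟧)) :=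
    (T.le 0).prop_of_iso (asIso ((D.truncLT 0).map φ)).symm (h.le_truncLT 0 hW₀.le)
  exact ⟨(T.le 0).prop_of_iso (@asIso _ _ _ _ _ e₂) h₁⟩

/-- If `T` is right `D`-compatible and the heart of `D` is generated by `H_D ∩ H_T[-n]`, then
`H_D` is contained in `T^{≥ n - 1}`. -/
lemma isGE_of_isRightCompatible {n : ℕ} (h : IsRightCompatible D T)
    (hg : Generates ((T.heart.shift (n : ℤ)).inverseImage D.heart.ι))
    (M : D.heart.FullSubcategory) : T.IsGE M.obj (n - 1) := by
  obtain ⟨X, hX, p, _⟩ := hg M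
  obtain ⟨K, i, k, hT⟩ := exists_distTriang_of_epi D p
  obtain ⟨X', hX', p', _⟩ := hg K
  obtain ⟨K', i', k', hT'⟩ := exists_distTriang_of_epi D p'
  obtain ⟨W, a, b, hW⟩ := distinguished_cocone_triangle (p'.hom ≫ i)
  -- Gives a triangle $K'[1]\to W\to M\to K'[2]$, so $M$ is $\delta^{\ge 0}W$.
  let H := someOctahedron rfl (rot_of_distTriang _ hT') hT hW
  have hX₀ : T.IsGE (X.obj⟦(n : ℤ)⟧) 0 := ⟨hX.2⟩
  have hX₀' : T.IsGE (X'.obj⟦(n : ℤ)⟧) 0 := ⟨hX'.2⟩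
  have hX₁ : T.IsGE X.obj n := T.isGE_of_shift _ n n 0
  have hX₁' : T.IsGE X'.obj n := T.isGE_of_shift _ n n 0
  have hW₀ : T.IsGE W (n - 1) := T.isGE₂ _ (rot_of_distTriang _ hW) (n - 1)
    (T.isGE_of_ge X.obj (n - 1) n) (T.isGE_shift X'.obj n 1 (n - 1))
  -- Compatibility concerns $\mathcal T^{\ge 0}$, so everything is shifted by $n-1$ and the cut
  -- moves from $0$ to $1-n$.
  have hW₁ : T.IsGE (W⟦(n - 1 : ℤ)⟧) 0 := T.isGE_shift W (n - 1) (n - 1) 0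
  have hM : D.IsGE M.obj 0 := ⟨M.property.2⟩
  have hM₁ : D.IsGE (M.obj⟦(n - 1 : ℤ)⟧) (1 - n) := D.isGE_shift _ 0 (n - 1) (1 - n)
  have hK' : D.IsLE K'.obj 0 := ⟨K'.property.1⟩
  have hK'₁ : D.IsLE (K'.obj⟦(1 : ℤ)⟧) (-1) := D.isLE_shift _ 0 1 (-1)
  have hK'₂ : D.IsLE (K'.obj⟦(1 : ℤ)⟧⟦(n - 1 : ℤ)⟧) (-n) := D.isLE_shift _ (-1) (n - 1) (-n)
  let S := (Triangle.shiftFunctor C (n - 1 : ℤ)).obj H.triangle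
  have e₁ : IsIso ((D.truncGE (1 - n)).map S.mor₂) :=
    D.isIso₂_truncGE_map_of_isLE S (Triangle.shift_distinguished _ H.mem _) (-n) (1 - n)
      (by lia) hK'₂
  have e₂ : IsIso ((D.truncGEπ (1 - n)).app (M.obj⟦(n - 1 : ℤ)⟧)) :=
    (D.isGE_iff_isIso_truncGEπ_app (1 - n) _).1 hM₁
  have hM₂ : T.IsGE (M.obj⟦(n - 1 : ℤ)⟧) 0 :=
    ⟨(T.ge 0).prop_of_iso (asIso ((D.truncGE (1 - n)).map S.mor₂) ≪≫
      (asIso ((D.truncGEπ (1 - n)).app (M.obj⟦(n - 1 : ℤ)⟧))).symm) (h (1 - n) _ hW₁.ge)⟩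
  exact T.isGE_of_shift _ (n - 1) (n - 1) 0

/-- If `H_D[1] ⊆ T^{≤ 0}` and `D^{≤ -n} ⊆ T^{≤ 0}` for some `n`, then `D^{≤ -1} ⊆ T^{≤ 0}`. -/
lemma le_neg_one_le_of_heart_shift
    (h : ∀ M : D.heart.FullSubcategory, T.IsLE (M.obj⟦(1 : ℤ)⟧) 0) (n : ℕ)
    (hn : D.le (-(n : ℤ)) ≤ T.le 0) : D.le (-1) ≤ T.le 0 := by
  induction n with
  | zero => exact (D.le_monotone (by lia)).trans hn
  | succ n ih =>
    -- Here `hn` is already the goal, and descending further would require $\mathcal H_{\mathcal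
    -- D}\subseteq\mathcal T^{\le 0}$.
    by_cases h0 : n = 0
    · subst h0
      simpa using hn
    · refine ih fun X hX ↦ ?_
      have hX' : D.IsLE X (-n) := ⟨hX⟩
      have h₁ : D.IsLE ((D.truncLT (-n)).obj X) (-((n + 1 : ℕ) : ℤ)) :=
        D.isLE_truncLT_obj _ _ _ (by lia)
      have h₂ : T.IsLE (((D.truncGE (-n)).obj X)⟦(-n : ℤ)⟧⟦(1 : ℤ)⟧) 0 :=
        h ⟨_, (D.mem_heart_iff _).2 ⟨D.isLE_shift _ (-n) (-n) 0, D.isGE_shift _ (-n) (-n) 0⟩⟩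
      have h₃ : T.IsLE (((D.truncGE (-n)).obj X)⟦(-n : ℤ)⟧) 1 := T.isLE_of_shift _ 1 1 0
      have h₄ : T.IsLE ((D.truncGE (-n)).obj X) (1 - n) := T.isLE_of_shift _ (1 - n) (-n) 1
      exact (T.isLE₂ _ (D.triangleLTGE_distinguished (-n) X) 0 ⟨hn _ h₁.le⟩
        (T.isLE_of_le ((D.truncGE (-n)).obj X) (1 - n) 0)).le

/-- If `H_D ⊆ T^{≥ m}` and `D^{≥ n} ⊆ T^{≥ m}` for some `n`, then `D^{≥ 0} ⊆ T^{≥ m}`. -/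
lemma ge_zero_le_of_heart {m : ℤ} (h : ∀ M : D.heart.FullSubcategory, T.IsGE M.obj m) (n : ℕ)
    (hn : D.ge n ≤ T.ge m) : D.ge 0 ≤ T.ge m := by
  induction n with
  | zero => simpa using hn
  | succ n ih =>
    refine ih fun X hX ↦ ?_
    have hX' : D.IsGE X n := ⟨hX⟩
    have h₁ : D.IsLE ((D.truncLT (n + 1)).obj X) n := D.isLE_truncLT_obj _ _ _ (by lia)
    have h₂ : T.IsGE (((D.truncLT (n + 1)).obj X)⟦(n : ℤ)⟧) m :=
      h ⟨_, (D.mem_heart_iff _).2 ⟨D.isLE_shift _ n n 0, D.isGE_shift _ n n 0⟩⟩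
    have h₃ : T.IsGE ((D.truncLT (n + 1)).obj X) (m + n) := T.isGE_of_shift _ (m + n) n m
    have h₄ : D.IsGE ((D.truncGE (n + 1)).obj X) ((n + 1 : ℕ) : ℤ) := by
      push_cast
      infer_instance
    exact (T.isGE₂ _ (D.triangleLTGE_distinguished (n + 1) X) m
      (T.isGE_of_ge ((D.truncLT (n + 1)).obj X) m (m + n)) ⟨hn _ h₄.ge⟩).ge

lemma IsTilting.gap_le_one {n : ℕ} (hDT : IsTilting D T n) (h : IsLeftCompatible D T) : n ≤ 1 :=
  hDT.ofType.gap.2 (le_neg_one_le_of_heart_shift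
    (isLE_shift_one_of_isLeftCompatible h hDT.cogenerates) n hDT.ofType.gap.1)

lemma IsCotilting.gap_le_one {n : ℕ} (hDT : IsCotilting D T n) (h : IsRightCompatible D T) :
    n ≤ 1 := by
  have h₀ : D.ge 0 ≤ T.ge 0 := by
    simpa using ge_of_le (le_add_of_le hDT.ofType.shift.1 (-1))
  have h₁ : D.ge n ≤ T.ge (n - 1) := by
    intro X hX
    have h₂ : T.IsGE (X⟦(n : ℤ)⟧) 0 := ⟨h₀ _ (D.ge_shift n n 0 (by lia) X hX)⟩
    have h₃ : T.IsGE X n := T.isGE_of_shift X n n 0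
    exact (T.isGE_of_ge X (n - 1) n).ge
  have h₂ : D.ge (-1 + 1) ≤ T.ge ((n - 2 : ℤ) + 1) := by
    rw [neg_add_cancel, show (n - 2 : ℤ) + 1 = n - 1 by ring]
    exact ge_zero_le_of_heart (isGE_of_isRightCompatible h hDT.generates) n h₁
  -- Orthogonals and a shift turn $\mathcal D^{\ge 0}\subseteq\mathcal T^{\ge n-1}$ into $\mathcal
  -- T^{\le n-1}\subseteq\mathcal D^{\le 0}$; the shift being $0$ forces $n-1\le 0$.
  have h₃ : (n - 2 : ℤ) + 1 ≤ 0 := hDT.ofType.shift.2 (le_add_of_le (le_of_ge h₂) 1)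
  lia

end Compatible

end Heart

end TStructurePair

theorem mainTheorem6 {C : Type u} [Category.{v} C] [Preadditive C] [HasZeroObject C]
    [HasShift C ℤ] [∀ n : ℤ, (shiftFunctor C n).Additive] [Pretriangulated C]
    [IsTriangulated C] (D T : TStructure C) (n : ℕ) :
    (TStructurePair.IsTilting D T n →
      (TStructurePair.IsLeftCompatible D T ↔ n = 0 ∨ n = 1)) ∧
    (TStructurePair.IsCotilting D T n →
      (TStructurePair.IsRightCompatible D T ↔ n = 0 ∨ n = 1) ∧
      (n = 0 ∨ n = 1 → TStructurePair.IsLeftCompatible D T)) := by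
  refine ⟨fun h ↦ ⟨fun hc ↦ ?_, fun hn ↦ ?_⟩, fun h ↦ ⟨⟨fun hc ↦ ?_, fun hn ↦ ?_⟩, fun hn ↦ ?_⟩⟩
  · have := h.gap_le_one hc
    lia
  · exact TStructurePair.isLeftCompatible_of_le h.ofType.shift.1 (h.ofType.le_neg_one hn)
  · have := h.gap_le_one hc
    lia
  · exact TStructurePair.isRightCompatible_of_le h.ofType.shift.1 (h.ofType.le_neg_one hn)
  · exact TStructurePair.isLeftCompatible_of_le h.ofType.shift.1 (h.ofType.le_neg_one hn)
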